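/- Let $T_0=([0,1]\times[0,1])\cup([-\tfrac12,\tfrac32]\times[1,\tfrac32])$ be the T-shaped polygon. For every finite binary string $s$ (of length $|s|$) and every element $g$ of the Klein four-group generated by the reflection $r_v$ in a vertical line and the reflection $r_h$ in a horizontal line, take a copy $T^s_g$ of $T_0$, scaled by $2^{-|s|}$ and reflected by $g$, with its corners and the end points $(0,\tfrac32),(1,\tfrac32)$ of the attaching segments removed. Glue these polygons as follows. (i) Every vertical side of $T^s_g$ is glued by translation to the same side of $T^s_{r_vg}$. The undersides of the two arms and the middle part $[0,1]\times\{\tfrac32\}$ of the top side of $T^s_g$ are glued by translation to the same segments of $T^s_{r_hg}$. (ii) The base $[0,1]\times\{0\}$ of $T^{\epsilon}_g$, with $\epsilon$ the empty string, is glued to the base of $T^{\epsilon}_{r_hg}$. (iii) The base of $T^{s0}_g$ is glued to the top left segment $[-\tfrac12,0]\times\{\tfrac32\}$ of $T^s_g$, and the base of $T^{s1}_g$ to the top right segment $[1,\tfrac32]\times\{\tfrac32\}$ of $T^s_g$. The result is the $T$-fractal surface $\mathring{\mathcal T}$. Its metric $d$ is the path metric: the infimum of the Euclidean lengths of the piecewise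 straight paths joining two points. Let $\mathcal T$ be the metric completion of $\mathring{\mathcal T}$, with its metric again denoted $d$. Let $\mathcal Q^s\subset\mathcal T$ be the quad-T subsurface with index $s$, that is, the closure in $\mathcal T$ of the union of the four polygons $T^s_g$. The set of elusive singularities is $\mathcal E=\mathcal T\setminus\bigcup_s\mathcal Q^s$. An address of $x\in\mathcal E$ is an infinite binary string $a$ such that $x$ is the limit of a sequence of points $y_n\in\mathring{\mathcal T}$, where $y_n$ lies in $\mathcal Q^{s_n}$ and $s_n$ is the string of the first $n$ bits of $a$. **Theorem.** Every $x\in\mathcal E$ has exactly one address $\alpha(x)$, and $\alpha$ is a bijection from $\mathcal E$ onto the set of all infinite binary strings. Let $d_2(x,y)=2^{-|\alpha(x)\wedge\alpha(y)|}$ for $x\neq y$ and $d_2(x,x)=0$, where $|a\wedge b|$ is the length of the longest common initial segment of $a$ and $b$; this is the 2-adic metric on $\mathcal E$. Then each of the metric spaces $(\mathcal E,d)$ and $(\mathcal E,d_2)$ is a Cantor set (it is homeomorphic to the ternary Cantor set) and has Hausdorff dimension $1$. Moreover, there is a real number $M$ such that $\operatorname{diam}_d\mathcal Q^s\le M\cdot2^{-|s|}$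 for all $s$, and for every such $M$ $$d_2(x,y)\le d(x,y)\le 3M\,d_2(x,y)\qquad\text{for all }x,y\in\mathcal E.$$ -/

import Mathlib

open Set Filter Topology
open scoped ENNReal

noncomputable section

namespace TFractal

/-- The T-shaped polygon `T₀`: the unit square `[0,1] × [0,1]` with the
`2 × 1/2` rectangle `[-1/2,3/2] × [1,3/2]` on top of it, in the plane `ℂ`. -/
def polygon : Set ℂ :=
  {z | 0 ≤ z.re ∧ z.re ≤ 1 ∧ 0 ≤ z.im ∧ z.im ≤ 1} ∪
  {z | -1 / 2 ≤ z.re ∧ z.re ≤ 3 / 2 ∧ 1 ≤ z.im ∧ z.im ≤ 3 / 2}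

/-- The eight corners of `T₀`, together with the inner end points of the two
segments of its top side to which smaller copies of `T₀` are attached. -/
def corners : Set ℂ :=
  {⟨0, 0⟩, ⟨1, 0⟩, ⟨1, 1⟩, ⟨3 / 2, 1⟩, ⟨3 / 2, 3 / 2⟩, ⟨1, 3 / 2⟩,
    ⟨0, 3 / 2⟩, ⟨-1 / 2, 3 / 2⟩, ⟨-1 / 2, 1⟩, ⟨0, 1⟩}

/-- `T₀` with its corners removed. -/
def puncturedPolygon : Set ℂ := polygon \ corners

/-- The vertical sides of `T₀`, all of which are walls of the billiard table. -/
def verticalWalls : Set ℂ :=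
  {z | ((z.re = 0 ∨ z.re = 1) ∧ z.im ≤ 1) ∨ z.re = -1 / 2 ∨ z.re = 3 / 2}

/-- The horizontal walls of `T₀`: the undersides of the two arms and the middle part
of the top side. The base and the two outer parts of the top side are not included. -/
def horizontalWalls : Set ℂ :=
  {z | ((z.re < 0 ∨ 1 < z.re) ∧ z.im = 1) ∨ (0 < z.re ∧ z.re < 1 ∧ z.im = 3 / 2)}

/-- The similarity of ratio `1/2` which places a copy of `T₀` on the top left
(`false`, the bit `0`) or top right (`true`, the bit `1`) part of `T₀`. -/
def attachMap (b : Bool) (z : ℂ) : ℂ :=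
  (if b then ⟨1, 3 / 2⟩ else ⟨-1 / 2, 3 / 2⟩) + z / 2

/-- A point of the disjoint union of the polygons from which the surface is glued. The
polygon with index `(sheet, addr)` is a copy of the punctured `T₀`, scaled by
`2 ^ (-|addr|)`, and reflected as `sheet` says: the four sheets are the four elements of the
Klein group generated by the reflections in a vertical line (first bit) and in a horizontal
line (second bit). The point is recorded by its position `pos` in the unscaled and
unreflected `T₀`. -/
@[ext]
structure Piece where
  sheet : Bool × Bool
  addr : List Bool
  pos : ℂ
  mem : pos ∈ puncturedPolygon

/-- The edge identifications. Walls are glued as in the unfolding of a billiard table: a wall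
in one sheet is glued to the same wall in the sheet obtained by the reflection in that
wall (in the reflected polygons this is a translation). Within each sheet, the base of the
polygon with address `s b` is glued to the top left or top right part of
the polygon with address `s`. -/
inductive Glue : Piece → Piece → Prop
  | vertical (g₁ g₂ : Bool) (s : List Bool) (p : ℂ) (hp : p ∈ puncturedPolygon)
      (hw : p ∈ verticalWalls) : Glue ⟨(g₁, g₂), s, p, hp⟩ ⟨(!g₁, g₂), s, p, hp⟩
  | horizontal (g₁ g₂ : Bool) (s : List Bool) (p : ℂ) (hp : p ∈ puncturedPolygon)
      (hw : p ∈ horizontalWalls) : Glue ⟨(g₁, g₂), s, p, hp⟩ ⟨(g₁, !g₂), s, p, hp⟩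
  | rootBase (g₁ g₂ : Bool) (p : ℂ) (hp : p ∈ puncturedPolygon)
      (hw : p.im = 0) : Glue ⟨(g₁, g₂), [], p, hp⟩ ⟨(g₁, !g₂), [], p, hp⟩
  | attach (g : Bool × Bool) (s : List Bool) (b : Bool) (p : ℂ) (hp : p ∈ puncturedPolygon)
      (hp' : attachMap b p ∈ puncturedPolygon) (hw : p.im = 0) :
      Glue ⟨g, s, attachMap b p, hp'⟩ ⟨g, s ++ [b], p, hp⟩

/-- The `T`-fractal surface. -/
def Surface : Type := Quot Glue

/-- The point of the surface represented by a point of one of the polygons. -/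
def mk (x : Piece) : Surface := Quot.mk Glue x

/-- `IsSegment x y ℓ`: some straight segment of length `ℓ` inside one of the polygons
(avoiding the corners) joins `x` to `y`. -/
def IsSegment (x y : Surface) (ℓ : ℝ) : Prop :=
  ∃ (g : Bool × Bool) (s : List Bool) (p q : ℂ) (hp : p ∈ puncturedPolygon)
    (hq : q ∈ puncturedPolygon), segment ℝ p q ⊆ puncturedPolygon ∧
    x = mk ⟨g, s, p, hp⟩ ∧ y = mk ⟨g, s, q, hq⟩ ∧ ℓ = (1 / 2) ^ s.length * dist p q

/-- `IsPath x y ℓ`: some piecewise straight path of length `ℓ` on the surface joins `x` to `y`. -/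
inductive IsPath : Surface → Surface → ℝ → Prop
  | nil (x : Surface) : IsPath x x 0
  | cons {x y z : Surface} {ℓ ℓ' : ℝ} : IsSegment x y ℓ → IsPath y z ℓ' → IsPath x z (ℓ + ℓ')

theorem IsSegment.symm {x y : Surface} {ℓ : ℝ} (h : IsSegment x y ℓ) : IsSegment y x ℓ := by
  obtain ⟨g, s, p, q, hp, hq, hs, hx, hy, hl⟩ := h
  exact ⟨g, s, q, p, hq, hp, by rwa [segment_symm], hy, hx, by rwa [dist_comm]⟩

theorem IsPath.trans {x y z : Surface} {ℓ ℓ' : ℝ} (h : IsPath x y ℓ) (h' : IsPath y z ℓ') :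
    IsPath x z (ℓ + ℓ') := by
  induction h with
  | nil x => simpa using h'
  | cons hs _ ih => rw [add_assoc]; exact .cons hs (ih h')

theorem IsSegment.isPath {x y : Surface} {ℓ : ℝ} (h : IsSegment x y ℓ) : IsPath x y ℓ := by
  simpa using IsPath.cons h (.nil y)

theorem IsPath.symm {x y : Surface} {ℓ : ℝ} (h : IsPath x y ℓ) : IsPath y x ℓ := by
  induction h with
  | nil x => exact .nil x
  | cons hs _ ih => rw [add_comm]; exact ih.trans hs.symm.isPath

theorem IsPath.nonneg {x y : Surface} {ℓ : ℝ} (h : IsPath x y ℓ) : 0 ≤ ℓ := by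
  induction h with
  | nil x => exact le_rfl
  | cons hs _ ih =>
    obtain ⟨g, s, p, q, hp, hq, -, -, -, rfl⟩ := hs
    positivity

/-- A centre, with respect to which the punctured `T₀` is star-shaped. -/
def centre : ℂ := ⟨1 / 2, 5 / 4⟩

theorem mem_corners_iff (z : ℂ) : z ∈ corners ↔
    (((z.re = 0 ∨ z.re = 1) ∧ (z.im = 0 ∨ z.im = 1 ∨ z.im = 3 / 2)) ∨
      ((z.re = -1 / 2 ∨ z.re = 3 / 2) ∧ (z.im = 1 ∨ z.im = 3 / 2))) := by
  simp only [corners, mem_insert_iff, mem_singleton_iff, Complex.ext_iff]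
  tauto

theorem segment_subset {p : ℂ} (hp : p ∈ puncturedPolygon) :
    segment ℝ p centre ⊆ puncturedPolygon := by
  rintro z ⟨a, b, ha, hb, hab, rfl⟩
  rcases hb.eq_or_lt with rfl | hb
  · obtain rfl : a = 1 := by linarith
    simpa using hp
  obtain rfl : a = 1 - b := by linarith
  have hre : ((1 - b) • p + b • centre).re = (1 - b) * p.re + b * (1 / 2) := by
    simp [centre]
  have him : ((1 - b) • p + b • centre).im = (1 - b) * p.im + b * (5 / 4) := by
    simp [centre]
  refine ⟨?_, ?_⟩
  · rcases hp.1 with ⟨h1, h2, h3, h4⟩ | ⟨h1, h2, h3, h4⟩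
    · by_cases h : ((1 - b) • p + b • centre).im ≤ 1
      · refine Or.inl ⟨?_, ?_, ?_, h⟩ <;> simp only [hre, him] <;> nlinarith
      · refine Or.inr ⟨?_, ?_, (not_le.1 h).le, ?_⟩ <;> simp only [hre, him] <;> nlinarith
    · refine Or.inr ⟨?_, ?_, ?_, ?_⟩ <;> simp only [hre, him] <;> nlinarith
  · rw [mem_corners_iff, hre, him]
    rcases hp.1 with ⟨h1, h2, h3, h4⟩ | ⟨h1, h2, h3, h4⟩
    · have e1 : 0 < (1 - b) * p.re + b * (1 / 2) := by nlinarith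
      have e2 : (1 - b) * p.re + b * (1 / 2) < 1 := by nlinarith
      rintro (⟨h | h, -⟩ | ⟨h | h, -⟩) <;> linarith
    · have e1 : 1 < (1 - b) * p.im + b * (5 / 4) := by nlinarith
      have e2 : (1 - b) * p.im + b * (5 / 4) < 3 / 2 := by nlinarith
      rintro (⟨-, h | h | h⟩ | ⟨-, h | h⟩) <;> linarith

theorem centre_mem : centre ∈ puncturedPolygon := by
  refine ⟨Or.inr ?_, ?_⟩
  · norm_num [centre]
  · rw [mem_corners_iff]; norm_num [centre]

theorem exists_isPath_centre (g : Bool × Bool) (s : List Bool) (p : ℂ)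
    (hp : p ∈ puncturedPolygon) :
    ∃ ℓ, IsPath (mk ⟨g, s, p, hp⟩) (mk ⟨g, s, centre, centre_mem⟩) ℓ :=
  ⟨_, IsSegment.isPath ⟨g, s, p, centre, hp, centre_mem, segment_subset hp, rfl, rfl, rfl⟩⟩

theorem exists_isPath_of_glue {x y : Piece} (h : Glue x y) :
    ∃ ℓ, IsPath (mk ⟨x.sheet, x.addr, centre, centre_mem⟩)
      (mk ⟨y.sheet, y.addr, centre, centre_mem⟩) ℓ := by
  obtain ⟨ℓ, h1⟩ := exists_isPath_centre x.sheet x.addr x.pos x.mem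
  obtain ⟨ℓ', h2⟩ := exists_isPath_centre y.sheet y.addr y.pos y.mem
  have e : mk ⟨x.sheet, x.addr, x.pos, x.mem⟩ = mk ⟨y.sheet, y.addr, y.pos, y.mem⟩ :=
    Quot.sound h
  rw [← e] at h2
  exact ⟨_, h1.symm.trans h2⟩

theorem exists_isPath_root (g₁ g₂ : Bool) (s : List Bool) :
    ∃ ℓ, IsPath (mk ⟨(g₁, g₂), s, centre, centre_mem⟩)
      (mk ⟨(false, false), [], centre, centre_mem⟩) ℓ := by
  induction s using List.reverseRecOn with
  | nil =>
    have hv : (⟨0, 1 / 2⟩ : ℂ) ∈ puncturedPolygon :=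
      ⟨Or.inl (by norm_num), by rw [mem_corners_iff]; norm_num⟩
    have hh : (⟨1 / 2, 0⟩ : ℂ) ∈ puncturedPolygon :=
      ⟨Or.inl (by norm_num), by rw [mem_corners_iff]; norm_num⟩
    have A : ∀ g₂, ∃ ℓ, IsPath (mk ⟨(true, g₂), [], centre, centre_mem⟩)
        (mk ⟨(false, g₂), [], centre, centre_mem⟩) ℓ := fun g₂ =>
      exists_isPath_of_glue (.vertical true g₂ [] _ hv (Or.inl (by norm_num)))
    have B : ∃ ℓ, IsPath (mk ⟨(false, true), [], centre, centre_mem⟩)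
        (mk ⟨(false, false), [], centre, centre_mem⟩) ℓ :=
      exists_isPath_of_glue (.rootBase false true _ hh rfl)
    cases g₁ <;> cases g₂
    · exact ⟨_, .nil _⟩
    · exact B
    · exact A false
    · obtain ⟨_, h1⟩ := A true
      obtain ⟨_, h2⟩ := B
      exact ⟨_, h1.trans h2⟩
  | append_singleton s b ih =>
    have hh : (⟨1 / 2, 0⟩ : ℂ) ∈ puncturedPolygon :=
      ⟨Or.inl (by norm_num), by rw [mem_corners_iff]; norm_num⟩
    have hh' : attachMap b ⟨1 / 2, 0⟩ ∈ puncturedPolygon := by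
      cases b
      · exact ⟨Or.inr (by norm_num [attachMap]),
          by rw [mem_corners_iff]; norm_num [attachMap]⟩
      · exact ⟨Or.inr (by norm_num [attachMap]),
          by rw [mem_corners_iff]; norm_num [attachMap]⟩
    obtain ⟨_, h1⟩ := exists_isPath_of_glue (.attach (g₁, g₂) s b _ hh hh' rfl)
    obtain ⟨_, h2⟩ := ih
    exact ⟨_, h1.symm.trans h2⟩

/-- The surface is path connected by piecewise straight paths. -/
theorem exists_isPath (x y : Surface) : ∃ ℓ, IsPath x y ℓ := by
  have A : ∀ x : Surface, ∃ ℓ, IsPath x (mk ⟨(false, false), [], centre, centre_mem⟩) ℓ := by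
    rintro ⟨⟨⟨g₁, g₂⟩, s, p, hp⟩⟩
    obtain ⟨_, h1⟩ := exists_isPath_centre (g₁, g₂) s p hp
    obtain ⟨_, h2⟩ := exists_isPath_root g₁ g₂ s
    exact ⟨_, h1.trans h2⟩
  obtain ⟨_, h1⟩ := A x
  obtain ⟨_, h2⟩ := A y
  exact ⟨_, h1.trans h2.symm⟩

/-- The distance of two points of the surface: the infimum of the Euclidean lengths of the
piecewise straight paths which join them. -/
def pathDist (x y : Surface) : ℝ := sInf {ℓ | IsPath x y ℓ}

theorem bddBelow_isPath (x y : Surface) : BddBelow {ℓ | IsPath x y ℓ} :=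
  ⟨0, fun _ h => h.nonneg⟩

instance : PseudoMetricSpace Surface where
  dist := pathDist
  dist_self x := le_antisymm (csInf_le (bddBelow_isPath x x) (.nil x))
    (le_csInf (exists_isPath x x) fun _ h => h.nonneg)
  dist_comm x y := by
    unfold pathDist
    congr 1
    ext ℓ
    exact ⟨IsPath.symm, IsPath.symm⟩
  dist_triangle x y z := by
    have h : ∀ ℓ, IsPath x y ℓ → pathDist x z - ℓ ≤ pathDist y z := fun ℓ hl =>
      le_csInf (exists_isPath y z) fun ℓ' hl' => by
        have := csInf_le (bddBelow_isPath x z) (hl.trans hl')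
        unfold pathDist
        linarith
    have h' : pathDist x z - pathDist y z ≤ pathDist x y :=
      le_csInf (exists_isPath x y) fun ℓ hl => by linarith [h ℓ hl]
    linarith

theorem dist_eq (x y : Surface) : dist x y = sInf {ℓ | IsPath x y ℓ} := rfl

/-- The metric completion of the `T`-fractal surface. -/
abbrev CompletedSurface : Type := UniformSpace.Completion Surface

/-- The points of the surface which lie in the four polygons with address `s`. -/
def openQuadT (s : List Bool) : Set Surface :=
  {x | ∃ (g : Bool × Bool) (p : ℂ) (hp : p ∈ puncturedPolygon), x = mk ⟨g, s, p, hp⟩}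

/-- The quad-T subsurface with address `s`, including its corners. -/
def quadT (s : List Bool) : Set CompletedSurface :=
  closure ((fun x : Surface => (x : CompletedSurface)) '' openQuadT s)

/-- The set of elusive singularities. -/
def elusive : Set CompletedSurface := univ \ ⋃ s : List Bool, quadT s

/-- The first `n` bits of an infinite binary string. -/
def initial (a : ℕ → Bool) (n : ℕ) : List Bool := List.ofFn fun i : Fin n => a i

/-- The infinite binary string `a` is an address of `x`: some sequence of points of the
surface, the `n`-th of which lies in the quad-T subsurface indexed by the first `n` bits of `a`,
converges to `x`. -/
def IsAddress (x : CompletedSurface) (a : ℕ → Bool) : Prop :=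
  ∃ y : ℕ → Surface, (∀ n, y n ∈ openQuadT (initial a n)) ∧
    Tendsto (fun n => (y n : CompletedSurface)) atTop (𝓝 x)

/-- The 2-adic metric on infinite binary strings: the distance of two distinct strings
is `2 ^ (-n)`, with `n` the length of their longest common initial segment. -/
abbrev stringMetric : MetricSpace (ℕ → Bool) := PiNat.metricSpace

theorem stringMetric_dist {a b : ℕ → Bool} (h : a ≠ b) :
    stringMetric.dist a b = (1 / 2) ^ PiNat.firstDiff a b :=
  PiNat.dist_eq_of_ne h

/-- The 2-adic metric on the elusive singularities, for a given bijection `α` between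
them and the infinite binary strings. -/
abbrev twoAdicMetric (α : elusive ≃ (ℕ → Bool)) : MetricSpace elusive :=
  @MetricSpace.induced _ _ α α.injective stringMetric

/-- The metric space `(X, m)` is a Cantor set (that is, it is homeomorphic to
the ternary Cantor set) of Hausdorff dimension `δ`. -/
def IsCantorSetOfDim (X : Type) (m : MetricSpace X) (δ : ℝ≥0∞) : Prop :=
  Nonempty (X ≃ₜ cantorSet) ∧ dimH (univ : Set X) = δ

end TFractal

end

namespace TFractal

/-! The bijection sends a binary string to the limit of a ray climbing through the polygons that it
indexes, and `d` is comparable with the 2-adic metric on strings. Any such space is a Cantor set of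
dimension `1` (`isCantorSetOfDim_one`): the `2 ^ n` cylinders of depth `n` bound its Hausdorff
measure, and binary expansion maps it by a 1-Lipschitz map onto a set containing `[0,1]`.

Path lengths are bounded below by functions compatible with the gluing and 1-Lipschitz on every
polygon (`abs_sub_le_dist`). With `height`, a fixed quad-T stays away from all deep polygons, so ray
limits are elusive. With `separator`, the two branches above a polygon are at least the width of its
base apart (`pow_le_dist_of_prefix`), which gives the lower bound and injectivity.

Upper bounds are geometric series: consecutive points of a ray share a quad-T, of diameter `O(2 ^
(-n))`. For surjectivity (`exists_eq_endPoint`), an elusive point is approximated by points of ever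
deeper polygons; separation of branches makes their addresses stabilise bit by bit, and the ray of
the limiting string converges to the point. -/

/-! ### Binary strings, Cantor sets and Hausdorff dimension. -/

theorem stringMetric_dist_le_of_eq {a b : ℕ → Bool} {n : ℕ} (h : ∀ i < n, a i = b i) :
    stringMetric.dist a b ≤ (1 / 2) ^ n :=
  (PiNat.mem_cylinder_iff_dist_le (E := fun _ => Bool)).1 h

/-- The real number in `[0,1]` with a given binary expansion. -/
noncomputable def binaryValue (a : ℕ → Bool) : ℝ :=
  Real.ofDigits (b := 2) fun i => if a i then 1 else 0

theorem abs_binaryValue_sub_le (a b : ℕ → Bool) :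
    |binaryValue a - binaryValue b| ≤ stringMetric.dist a b := by
  rcases eq_or_ne a b with rfl | h
  · simp
  · rw [stringMetric_dist h]
    refine (Real.abs_ofDigits_sub_ofDigits_le (n := PiNat.firstDiff a b) fun i hi => ?_).trans ?_
    · rw [PiNat.apply_eq_of_lt_firstDiff hi]
    · simp

theorem Icc_subset_range_binaryValue : Icc 0 1 ⊆ range binaryValue := by
  intro y hy
  obtain ⟨d, -, rfl⟩ := Real.ofDigits_SurjOn (b := 2) one_lt_two hy
  refine ⟨fun i => decide (d i = 1), ?_⟩
  unfold binaryValue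
  congr 1
  ext i
  rcases (by omega : d i = 0 ∨ d i = 1) with h | h <;> simp [h]

/-- A metric space in bi-Lipschitz bijection with the infinite binary strings is a Cantor set of
Hausdorff dimension `1`. -/
theorem isCantorSetOfDim_one {X : Type} (m : MetricSpace X) (α : X ≃ (ℕ → Bool)) (K : ℝ)
    (h₁ : ∀ x y, stringMetric.dist (α x) (α y) ≤ dist x y)
    (h₂ : ∀ x y, dist x y ≤ K * stringMetric.dist (α x) (α y)) :
    IsCantorSetOfDim X m 1 := by
  refine ⟨⟨Homeomorph.trans ⟨α, ?_, ?_⟩ cantorSetHomeomorphNatToBool.symm⟩, le_antisymm ?_ ?_⟩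
  · exact @LipschitzWith.continuous _ _ _ stringMetric.toPseudoEMetricSpace 1 _
      (@LipschitzWith.of_dist_le_mul _ _ _ stringMetric.toPseudoMetricSpace 1 _
        fun x y => by simpa using h₁ x y)
  · exact @LipschitzWith.continuous _ _ stringMetric.toPseudoEMetricSpace _ K.toNNReal _
      (@LipschitzWith.of_dist_le_mul _ _ stringMetric.toPseudoMetricSpace _ K.toNNReal _
        fun a b => by
          refine (h₂ _ _).trans ?_
          simp only [Equiv.invFun_as_coe, Equiv.apply_symm_apply, Real.coe_toNNReal']
          exact mul_le_mul_of_nonneg_right (le_max_left _ _)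
            (@dist_nonneg _ stringMetric.toPseudoMetricSpace a b))
  · borelize X
    have key : MeasureTheory.Measure.hausdorffMeasure 1 (univ : Set X) ≤ ENNReal.ofReal K := by
      -- Cover by the `2 ^ n` cylinders of depth `n`: their diameters are at most `K * 2 ^ (-n)`, so
      -- they sum to at most `K`.
      let t : ∀ n : ℕ, (Fin n → Bool) → Set X := fun n w => {x | ∀ i : Fin n, α x i = w i}
      have ht : ∀ n w, Metric.ediam (t n w) ≤ ENNReal.ofReal K * (1 / 2) ^ n := by
        intro n w
        refine Metric.ediam_le fun x hx y hy => ?_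
        rw [edist_dist]
        have e : (1 / 2 : ℝ≥0∞) ^ n = ENNReal.ofReal ((1 / 2) ^ n) := by
          rw [ENNReal.ofReal_pow (by norm_num), ENNReal.ofReal_div_of_pos (by norm_num)]
          simp
        rw [e, ← ENNReal.ofReal_mul' (by positivity)]
        have hK : 0 ≤ stringMetric.dist (α x) (α y) :=
          @dist_nonneg _ stringMetric.toPseudoMetricSpace _ _
        have hd : stringMetric.dist (α x) (α y) ≤ (1 / 2) ^ n :=
          stringMetric_dist_le_of_eq fun i hi => (hx ⟨i, hi⟩).trans (hy ⟨i, hi⟩).symm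
        -- The sign of `K` is not given; if `K ≤ 0`, all distances vanish.
        rcases le_total 0 K with h0 | h0
        · exact ENNReal.ofReal_le_ofReal ((h₂ x y).trans (mul_le_mul_of_nonneg_left hd h0))
        · rw [ENNReal.ofReal_of_nonpos]
          · exact zero_le
          · exact (h₂ x y).trans (mul_nonpos_of_nonpos_of_nonneg h0 hK)
      have hr : Tendsto (fun n : ℕ => ENNReal.ofReal K * (1 / 2 : ℝ≥0∞) ^ n) atTop (𝓝 0) := by
        have := ENNReal.Tendsto.const_mul (a := ENNReal.ofReal K)
          (ENNReal.tendsto_pow_atTop_nhds_zero_of_lt_one (r := 1 / 2)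
            (by simp)) (Or.inr ENNReal.ofReal_ne_top)
        simpa using this
      refine (MeasureTheory.Measure.hausdorffMeasure_le_liminf_sum 1 univ _ hr t
        (Eventually.of_forall ht) (Eventually.of_forall fun n x _ =>
          mem_iUnion.2 ⟨fun i => α x i, fun i => rfl⟩)).trans ?_
      refine liminf_le_of_le (by isBoundedDefault) fun b hb => ?_
      obtain ⟨n, hn⟩ := hb.exists
      refine hn.trans ?_
      calc ∑ w, Metric.ediam (t n w) ^ (1 : ℝ)
          ≤ ∑ w : Fin n → Bool, ENNReal.ofReal K * (1 / 2) ^ n :=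
            Finset.sum_le_sum fun w _ => by simpa using ht n w
        _ = ENNReal.ofReal K := by
            rw [Finset.sum_const, Finset.card_univ, nsmul_eq_mul]
            simp only [Fintype.card_pi, Fintype.card_bool, Finset.prod_const, Finset.card_univ,
              Fintype.card_fin, Nat.cast_pow, Nat.cast_ofNat]
            rw [mul_left_comm, ← mul_pow, ENNReal.mul_div_cancel (by simp) (by simp)]
            simp
    have : dimH (univ : Set X) ≤ ((1 : NNReal) : ℝ≥0∞) :=
      dimH_le_of_hausdorffMeasure_ne_top (ne_top_of_le_ne_top ENNReal.ofReal_ne_top (by simpa using key))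
    simpa using this
  · have hL : LipschitzWith 1 fun x => binaryValue (α x) :=
      LipschitzWith.of_dist_le_mul fun x y => by
        simpa [Real.dist_eq] using (abs_binaryValue_sub_le _ _).trans (h₁ x y)
    calc (1 : ℝ≥0∞) = dimH (Icc (0 : ℝ) 1) := by
          rw [Real.dimH_of_mem_nhds (Icc_mem_nhds (x := 1 / 2) (by norm_num) (by norm_num))]
          simp
      _ ≤ dimH (range fun x => binaryValue (α x)) := by
          refine dimH_mono fun y hy => ?_
          obtain ⟨a, rfl⟩ := Icc_subset_range_binaryValue hy
          exact ⟨α.symm a, by simp⟩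
      _ ≤ _ := hL.dimH_range_le

/-! ### Coordinates in the polygons. -/

theorem openQuadT_mem (x : Piece) : mk x ∈ openQuadT x.addr := ⟨_, _, x.mem, rfl⟩

theorem exists_mk_of_mem_openQuadT {s : List Bool} {x : Surface} (h : x ∈ openQuadT s) :
    ∃ y : Piece, y.addr = s ∧ mk y = x := by
  obtain ⟨g, p, hp, rfl⟩ := h
  exact ⟨⟨g, s, p, hp⟩, rfl, rfl⟩

theorem exists_mk (x : Surface) : ∃ y : Piece, mk y = x := Quot.exists_rep x

theorem im_mem_of_mem_polygon {p : ℂ} (hp : p ∈ polygon) : 0 ≤ p.im ∧ p.im ≤ 3 / 2 := by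
  rcases hp with ⟨h1, h2, h3, h4⟩ | ⟨h1, h2, h3, h4⟩ <;> constructor <;> linarith

theorem re_mem_of_mem_polygon {p : ℂ} (hp : p ∈ polygon) : -1 / 2 ≤ p.re ∧ p.re ≤ 3 / 2 := by
  rcases hp with ⟨h1, h2, h3, h4⟩ | ⟨h1, h2, h3, h4⟩ <;> constructor <;> linarith

theorem re_mem_of_mem_base {p : ℂ} (hp : p ∈ polygon) (h0 : p.im = 0) : 0 ≤ p.re ∧ p.re ≤ 1 := by
  rcases hp with ⟨h1, h2, h3, h4⟩ | ⟨h1, h2, h3, h4⟩ <;> constructor <;> linarith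

theorem attachMap_re (b : Bool) (z : ℂ) :
    (attachMap b z).re = (if b then 1 else -1 / 2) + z.re / 2 := by
  cases b <;> simp [attachMap]

theorem attachMap_im (b : Bool) (z : ℂ) : (attachMap b z).im = 3 / 2 + z.im / 2 := by
  cases b <;> simp [attachMap]

/-! ### Lower bounds for the path metric -/

/-- A function on the polygons which respects the gluing and does not increase lengths within the
polygons does not increase distances on the surface. -/
theorem abs_sub_le_dist {f : Piece → ℝ} (hg : ∀ x y, Glue x y → f x = f y)
    (hf : ∀ g s p q hp hq, |f ⟨g, s, p, hp⟩ - f ⟨g, s, q, hq⟩| ≤ (1 / 2) ^ s.length * dist p q)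
    (x y : Piece) : |f x - f y| ≤ dist (mk x) (mk y) := by
  have key : ∀ {u v : Surface} {ℓ : ℝ}, IsPath u v ℓ →
      |Quot.lift f hg u - Quot.lift f hg v| ≤ ℓ := by
    intro u v ℓ h
    induction h with
    | nil => simp
    | cons hs _ ih =>
      obtain ⟨g, s, p, q, hp, hq, -, rfl, rfl, rfl⟩ := hs
      exact (abs_sub_le _ _ _).trans (add_le_add (hf g s p q hp hq) ih)
  exact le_csInf (exists_isPath _ _) fun ℓ h => key h

/-- The imaginary part of the position in the plane of a point of the billiard table. -/
noncomputable def height (x : Piece) : ℝ := 3 - (1 / 2) ^ x.addr.length * (3 - x.pos.im)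

/-- The number `3 = 3/2 + 3/4 + ⋯` is the total height of the table and the fixed point of `y ↦ 3/2
+ y/2`, which makes `height` agree across attached bases. -/
theorem abs_height_sub_le_dist (x y : Piece) : |height x - height y| ≤ dist (mk x) (mk y) := by
  refine abs_sub_le_dist ?_ ?_ x y
  · intro x y h
    cases h with
    | vertical => rfl
    | horizontal => rfl
    | rootBase => rfl
    | attach g s b p hp hp' hw =>
      simp only [height, attachMap_im, hw, List.length_append, List.length_singleton, pow_succ]
      ring
  · intro g s p q hp hq
    have e : height ⟨g, s, p, hp⟩ - height ⟨g, s, q, hq⟩ = (1 / 2) ^ s.length * (p - q).im := by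
      simp only [height, Complex.sub_im]
      ring
    rw [e, abs_mul, abs_of_nonneg (by positivity), dist_eq_norm]
    gcongr
    exact Complex.abs_im_le_norm _

theorem three_sub_le_height (x : Piece) : 3 - 3 * (1 / 2) ^ x.addr.length ≤ height x := by
  have := (im_mem_of_mem_polygon x.mem.1).1
  have : (1 / 2 : ℝ) ^ x.addr.length * (3 - x.pos.im) ≤ (1 / 2) ^ x.addr.length * 3 := by
    gcongr
    linarith
  unfold height
  linarith

theorem height_le (x : Piece) : height x ≤ 3 - 3 / 2 * (1 / 2) ^ x.addr.length := by
  have := (im_mem_of_mem_polygon x.mem.1).2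
  have : (1 / 2 : ℝ) ^ x.addr.length * (3 / 2) ≤ (1 / 2) ^ x.addr.length * (3 - x.pos.im) := by
    gcongr
    linarith
  unfold height
  linarith

/-- The position in the plane of a point of a polygon of the billiard table. -/
noncomputable def place : List Bool → ℂ → ℂ
  | [], z => z
  | b :: s, z => attachMap b (place s z)

/-- `place` recurses on the head of the address while `Glue.attach` extends its tail; this
reconciles the two. -/
theorem place_append_singleton (s : List Bool) (b : Bool) (z : ℂ) :
    place (s ++ [b]) z = place s (attachMap b z) := by
  induction s with
  | nil => rfl
  | cons c s ih => simp [place, ih]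

theorem place_re (s : List Bool) (z : ℂ) :
    (place s z).re = (place s 0).re + (1 / 2) ^ s.length * z.re := by
  induction s with
  | nil => simp [place]
  | cons c s ih =>
    simp only [place, attachMap_re, List.length_cons, pow_succ]
    rw [ih]
    ring

/-- The horizontal position in the polygon with address `s`, clamped to the width of its base, and
constant on each of the two branches which are attached to this polygon. -/
noncomputable def separator (s : List Bool) (x : Piece) : ℝ :=
  if s ++ [false] <+: x.addr then 0
  else if s ++ [true] <+: x.addr then (1 / 2) ^ s.length
  else max 0 (min ((1 / 2) ^ s.length) ((place x.addr x.pos).re - (place s 0).re))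

/-- Only `attach` needs an argument. At a polygon other than `s`, both sides fall in the same case
and have the same place. At `s` itself, the left base lies over `re ≤ 0` and the right one over `re
≥ 1`, where clamping already gives the constant value of the branch. -/
theorem separator_eq_of_glue (s : List Bool) {x y : Piece} (h : Glue x y) :
    separator s x = separator s y := by
  cases h with
  | vertical => rfl
  | horizontal => rfl
  | rootBase => rfl
  | attach g t b p hp hp' hw =>
    obtain ⟨h0, h1⟩ := re_mem_of_mem_base hp.1 hw
    have hpos : (0 : ℝ) < (1 / 2) ^ s.length := by positivity
    have e : ∀ c : Bool, s ++ [c] <+: t ++ [b] ↔ (s = t ∧ c = b) ∨ s ++ [c] <+: t := by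
      intro c
      rw [List.prefix_concat_iff]
      refine or_congr_left ?_
      constructor
      · intro h
        exact ⟨List.append_inj_left' h rfl, by simpa using List.append_inj_right' h rfl⟩
      · rintro ⟨rfl, rfl⟩
        rfl
    simp only [separator, e, place_append_singleton]
    rcases eq_or_ne s t with rfl | hst
    · have hn : ∀ c : Bool, ¬ s ++ [c] <+: s := fun c hc => by
        simpa using hc.length_le
      simp only [hn, if_false, or_false, true_and]
      rw [place_re s (attachMap b p), attachMap_re, add_sub_cancel_left]
      cases b
      · simp only [Bool.false_eq_true, if_false, if_true]
        refine max_eq_left ((min_le_right _ _).trans ?_)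
        exact mul_nonpos_of_nonneg_of_nonpos hpos.le (by linarith)
      · simp only [Bool.false_eq_true, if_false, if_true]
        rw [min_eq_left, max_eq_right hpos.le]
        exact le_mul_of_one_le_right hpos.le (by linarith)
    · simp [hst]

theorem abs_separator_sub_le_dist (s : List Bool) (x y : Piece) :
    |separator s x - separator s y| ≤ dist (mk x) (mk y) := by
  refine abs_sub_le_dist (fun x y h => separator_eq_of_glue s h) ?_ x y
  intro g t p q hp hq
  simp only [separator]
  split_ifs
  · simp
  · simp
  · refine (abs_max_sub_max_le_max _ _ _ _).trans (max_le (by simp) ?_)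
    refine (abs_min_sub_min_le_max _ _ _ _).trans (max_le (by simp) ?_)
    rw [place_re t p, place_re t q]
    have e : (place t 0).re + (1 / 2) ^ t.length * p.re - (place s 0).re -
        ((place t 0).re + (1 / 2) ^ t.length * q.re - (place s 0).re) =
        (1 / 2) ^ t.length * (p - q).re := by
      simp only [Complex.sub_re]
      ring
    rw [e, abs_mul, abs_of_nonneg (by positivity), dist_eq_norm]
    gcongr
    exact Complex.abs_re_le_norm _

theorem not_prefix_of_prefix {s t : List Bool} {b c : Bool} (hbc : b ≠ c)
    (h : s ++ [b] <+: t) : ¬ s ++ [c] <+: t := by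
  intro h'
  have := (List.prefix_of_prefix_length_le h h' (by simp)).eq_of_length (by simp)
  simp at this
  exact hbc this

/-- The two branches attached to the polygon with address `s` have distance at least the width of
the base of this polygon. -/
theorem pow_le_dist_of_prefix {s : List Bool} {b c : Bool} (hbc : b ≠ c) {x y : Piece}
    (hx : s ++ [b] <+: x.addr) (hy : s ++ [c] <+: y.addr) :
    (1 / 2) ^ s.length ≤ dist (mk x) (mk y) := by
  wlog h : b = false generalizing b c x y
  · rw [dist_comm]
    refine this hbc.symm hy hx ?_
    cases b <;> cases c <;> simp_all
  obtain rfl : c = true := by cases c <;> simp_all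
  subst h
  have h1 : separator s x = 0 := if_pos hx
  have h2 : separator s y = (1 / 2) ^ s.length := by
    rw [separator, if_neg (not_prefix_of_prefix (by decide) hy), if_pos hy]
  have := abs_separator_sub_le_dist s x y
  rwa [h1, h2, zero_sub, abs_neg, abs_of_nonneg (by positivity)] at this

/-! ### Upper bounds for the path metric -/

theorem dist_mk_centre_le (g : Bool × Bool) (s : List Bool) (p : ℂ) (hp : p ∈ puncturedPolygon) :
    dist (mk ⟨g, s, p, hp⟩) (mk ⟨g, s, centre, centre_mem⟩) ≤ 9 / 4 * (1 / 2) ^ s.length := by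
  have h : dist (mk ⟨g, s, p, hp⟩) (mk ⟨g, s, centre, centre_mem⟩) ≤
      (1 / 2) ^ s.length * dist p centre :=
    csInf_le (bddBelow_isPath _ _)
      (IsSegment.isPath ⟨g, s, p, centre, hp, centre_mem, segment_subset hp, rfl, rfl, rfl⟩)
  -- The coordinates differ from those of the centre by at most `1` and `5/4`.
  have h' : dist p centre ≤ 9 / 4 := by
    rw [dist_eq_norm]
    refine (Complex.norm_le_abs_re_add_abs_im _).trans ?_
    have h1 := im_mem_of_mem_polygon hp.1
    have h2 := re_mem_of_mem_polygon hp.1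
    have e1 : |(p - centre).re| ≤ 1 := by
      rw [abs_le]; simp only [centre, Complex.sub_re]; constructor <;> linarith
    have e2 : |(p - centre).im| ≤ 5 / 4 := by
      rw [abs_le]; simp only [centre, Complex.sub_im]; constructor <;> linarith
    linarith
  rw [mul_comm (9 / 4)]
  exact h.trans (by gcongr)

theorem dist_centre_le_of_glue {g g' : Bool × Bool} {s : List Bool} {p : ℂ}
    {hp : p ∈ puncturedPolygon} (h : Glue ⟨g, s, p, hp⟩ ⟨g', s, p, hp⟩) :
    dist (mk ⟨g, s, centre, centre_mem⟩) (mk ⟨g', s, centre, centre_mem⟩) ≤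
      9 / 2 * (1 / 2) ^ s.length := by
  have e : mk ⟨g, s, p, hp⟩ = mk ⟨g', s, p, hp⟩ := Quot.sound h
  have h1 := dist_mk_centre_le g s p hp
  have h2 := dist_mk_centre_le g' s p hp
  rw [dist_comm, e] at h1
  rw [dist_comm (mk _)]
  rw [dist_comm] at h2
  have := dist_triangle_right (mk ⟨g', s, centre, centre_mem⟩) (mk ⟨g, s, centre, centre_mem⟩)
    (mk ⟨g', s, p, hp⟩)
  linarith

theorem dist_centre_le (g g' : Bool × Bool) (s : List Bool) :
    dist (mk ⟨g, s, centre, centre_mem⟩) (mk ⟨g', s, centre, centre_mem⟩) ≤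
      9 * (1 / 2) ^ s.length := by
  have hv : (⟨0, 1 / 2⟩ : ℂ) ∈ puncturedPolygon :=
    ⟨Or.inl (by norm_num), by rw [mem_corners_iff]; norm_num⟩
  -- A point of the top wall, since the base is glued to another sheet only at the root.
  have hh : (⟨1 / 2, 3 / 2⟩ : ℂ) ∈ puncturedPolygon :=
    ⟨Or.inr (by norm_num), by rw [mem_corners_iff]; norm_num⟩
  have A : ∀ a b c, dist (mk ⟨(a, c), s, centre, centre_mem⟩) (mk ⟨(b, c), s, centre, centre_mem⟩) ≤
      9 / 2 * (1 / 2) ^ s.length := by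
    intro a b c
    rcases eq_or_ne b a with rfl | h
    · rw [dist_self]; positivity
    · obtain rfl := Bool.eq_not_of_ne h
      exact dist_centre_le_of_glue (.vertical a c s _ hv (Or.inl (by norm_num)))
  have B : ∀ a b c, dist (mk ⟨(c, a), s, centre, centre_mem⟩) (mk ⟨(c, b), s, centre, centre_mem⟩) ≤
      9 / 2 * (1 / 2) ^ s.length := by
    intro a b c
    rcases eq_or_ne b a with rfl | h
    · rw [dist_self]; positivity
    · obtain rfl := Bool.eq_not_of_ne h
      exact dist_centre_le_of_glue (.horizontal c a s _ hh (Or.inr (by norm_num)))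
  obtain ⟨a, b⟩ := g
  obtain ⟨a', b'⟩ := g'
  linarith [dist_triangle (mk ⟨(a, b), s, centre, centre_mem⟩) (mk ⟨(a', b), s, centre, centre_mem⟩)
    (mk ⟨(a', b'), s, centre, centre_mem⟩), A a a' b, B b b' a']

/-- Through the centres, `9/4 + 9 + 9/4 ≤ 14`. -/
theorem dist_le_of_mem_openQuadT {s : List Bool} {x y : Surface} (hx : x ∈ openQuadT s)
    (hy : y ∈ openQuadT s) : dist x y ≤ 14 * (1 / 2) ^ s.length := by
  obtain ⟨g, p, hp, rfl⟩ := hx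
  obtain ⟨g', q, hq, rfl⟩ := hy
  have h1 := dist_mk_centre_le g s p hp
  have h2 := dist_mk_centre_le g' s q hq
  rw [dist_comm] at h2
  have h3 := dist_centre_le g g' s
  have h4 := dist_triangle4 (mk ⟨g, s, p, hp⟩) (mk ⟨g, s, centre, centre_mem⟩)
    (mk ⟨g', s, centre, centre_mem⟩) (mk ⟨g', s, q, hq⟩)
  have : (0 : ℝ) < (1 / 2) ^ s.length := by positivity
  linarith

theorem coe_mem_quadT {s : List Bool} {x : Surface} (h : x ∈ openQuadT s) :
    (x : CompletedSurface) ∈ quadT s :=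
  subset_closure ⟨x, h, rfl⟩

theorem dist_le_of_mem_quadT {s : List Bool} {x y : CompletedSurface} (hx : x ∈ quadT s)
    (hy : y ∈ quadT s) : dist x y ≤ 14 * (1 / 2) ^ s.length := by
  refine le_of_forall_pos_le_add fun ε hε => ?_
  obtain ⟨_, ⟨x', hx', rfl⟩, h1⟩ := Metric.mem_closure_iff.1 hx (ε / 2) (by positivity)
  obtain ⟨_, ⟨y', hy', rfl⟩, h2⟩ := Metric.mem_closure_iff.1 hy (ε / 2) (by positivity)
  rw [dist_comm] at h2
  have h3 := dist_le_of_mem_openQuadT hx' hy'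
  rw [← UniformSpace.Completion.dist_eq] at h3
  linarith [dist_triangle4 x x' y' y]

theorem baseMidpoint_mem : (⟨1 / 2, 0⟩ : ℂ) ∈ puncturedPolygon :=
  ⟨Or.inl (by norm_num), by rw [mem_corners_iff]; norm_num⟩

/-- The midpoint of the base of a polygon with a given address. -/
noncomputable def basePiece (s : List Bool) : Piece := ⟨(false, false), s, ⟨1 / 2, 0⟩, baseMidpoint_mem⟩

theorem mk_basePiece_mem (s : List Bool) : mk (basePiece s) ∈ openQuadT s :=
  openQuadT_mem (basePiece s)

theorem mk_basePiece_append_mem (s : List Bool) (b : Bool) :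
    mk (basePiece (s ++ [b])) ∈ openQuadT s := by
  have h : attachMap b ⟨1 / 2, 0⟩ ∈ puncturedPolygon := by
    refine ⟨Or.inr ?_, ?_⟩
    · simp only [mem_ofPred_eq, attachMap_re, attachMap_im]
      cases b <;> norm_num
    · rw [mem_corners_iff, attachMap_re, attachMap_im]
      cases b <;> norm_num
  exact ⟨(false, false), _, h,
    (Quot.sound (Glue.attach (false, false) s b _ baseMidpoint_mem h rfl)).symm⟩

/-- Telescoping: a step at depth `k` costs `14 * 2 ^ (-k) = 28 * 2 ^ (-k) - 28 * 2 ^ (-(k + 1))`.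
The subtracted term drives the induction and later absorbs a last step inside one quad-T. -/
theorem dist_basePiece_append_le (s t : List Bool) :
    dist (mk (basePiece s)) (mk (basePiece (s ++ t))) ≤
      28 * (1 / 2) ^ s.length - 28 * (1 / 2) ^ (s ++ t).length := by
  induction t using List.reverseRecOn with
  | nil => simp
  | append_singleton t b ih =>
    have h := dist_le_of_mem_openQuadT (mk_basePiece_mem (s ++ t))
      (mk_basePiece_append_mem (s ++ t) b)
    rw [← List.append_assoc, List.length_append (bs := [b]), List.length_singleton, pow_succ]
    linarith [dist_triangle (mk (basePiece s)) (mk (basePiece (s ++ t)))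
      (mk (basePiece (s ++ t ++ [b])))]

/-- The branch of the surface above the polygons with address `s` has diameter comparable to
the size of these polygons. -/
theorem dist_basePiece_le_of_prefix {s : List Bool} {x : Piece} (h : s <+: x.addr) :
    dist (mk (basePiece s)) (mk x) ≤ 28 * (1 / 2) ^ s.length := by
  obtain ⟨t, ht⟩ := h
  have h1 := dist_basePiece_append_le s t
  rw [ht] at h1
  have h2 := dist_le_of_mem_openQuadT (mk_basePiece_mem x.addr) (openQuadT_mem x)
  have : (0 : ℝ) < (1 / 2) ^ x.addr.length := by positivity
  linarith [dist_triangle (mk (basePiece s)) (mk (basePiece x.addr)) (mk x)]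

/-! ### Rays and their end points. -/

theorem length_initial (a : ℕ → Bool) (n : ℕ) : (initial a n).length = n := List.length_ofFn

theorem initial_succ (a : ℕ → Bool) (n : ℕ) : initial a (n + 1) = initial a n ++ [a n] := by
  rw [initial, List.ofFn_succ_last]
  rfl

theorem initial_congr {a b : ℕ → Bool} {n : ℕ} (h : ∀ i < n, a i = b i) :
    initial a n = initial b n := by
  unfold initial
  congr 1
  ext i
  exact h i i.2

theorem initial_prefix (a : ℕ → Bool) {m n : ℕ} (h : m ≤ n) : initial a m <+: initial a n := by
  induction n, h using Nat.le_induction with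
  | base => exact List.prefix_rfl
  | succ n _ ih => rw [initial_succ]; exact ih.trans (List.prefix_append _ _)

/-- Points of the surface which move up the branch with the infinite address `a`. -/
noncomputable def ray (a : ℕ → Bool) (n : ℕ) : CompletedSurface :=
  (mk (basePiece (initial a n)) : Surface)

theorem ray_mem_quadT (a : ℕ → Bool) (n : ℕ) : ray a n ∈ quadT (initial a n) :=
  coe_mem_quadT (mk_basePiece_mem _)

theorem ray_succ_mem_quadT (a : ℕ → Bool) (n : ℕ) : ray a (n + 1) ∈ quadT (initial a n) := by
  rw [ray, initial_succ]
  exact coe_mem_quadT (mk_basePiece_append_mem _ _)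

theorem dist_ray_succ_le {M : ℝ}
    (hM : ∀ s, ∀ x ∈ quadT s, ∀ y ∈ quadT s, dist x y ≤ M * (1 / 2) ^ s.length)
    (a : ℕ → Bool) (n : ℕ) : dist (ray a n) (ray a (n + 1)) ≤ M * (1 / 2) ^ n := by
  simpa only [length_initial] using hM _ _ (ray_mem_quadT a n) _ (ray_succ_mem_quadT a n)

theorem exists_tendsto_ray (a : ℕ → Bool) : ∃ x, Tendsto (ray a) atTop (𝓝 x) :=
  cauchySeq_tendsto_of_complete (cauchySeq_of_le_geometric (1 / 2) 14 (by norm_num)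
    (dist_ray_succ_le (fun _ _ hx _ hy => dist_le_of_mem_quadT hx hy) a))

/-- The elusive singularity with a given address. -/
noncomputable def endPoint (a : ℕ → Bool) : CompletedSurface := (exists_tendsto_ray a).choose

theorem tendsto_ray (a : ℕ → Bool) : Tendsto (ray a) atTop (𝓝 (endPoint a)) :=
  (exists_tendsto_ray a).choose_spec

theorem endPoint_mem_elusive (a : ℕ → Bool) : endPoint a ∈ elusive := by
  refine ⟨mem_univ _, fun h => ?_⟩
  obtain ⟨s, hs⟩ := mem_iUnion.1 h
  have hpos : (0 : ℝ) < (1 / 2) ^ s.length := by positivity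
  obtain ⟨_, ⟨z, hz, rfl⟩, h1⟩ := Metric.mem_closure_iff.1 hs ((1 / 2) ^ s.length / 2) (by positivity)
  -- Three levels up, heights exceed those in the quad-T by at least `(3/2 - 3/8) * 2 ^ (-|s|)`,
  -- more than the two errors `2 ^ (-|s|) / 2` together.
  obtain ⟨n, hn, h2⟩ := ((eventually_ge_atTop (s.length + 3)).and
    (Metric.tendsto_nhds.1 (tendsto_ray a) ((1 / 2) ^ s.length / 2) (by positivity))).exists
  obtain ⟨z, rfl, rfl⟩ := exists_mk_of_mem_openQuadT hz
  have h3 := abs_height_sub_le_dist (basePiece (initial a n)) z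
  rw [← UniformSpace.Completion.dist_eq] at h3
  have h4 := three_sub_le_height (basePiece (initial a n))
  have h5 := height_le z
  have h6 : (1 / 2 : ℝ) ^ (basePiece (initial a n)).addr.length ≤ (1 / 2) ^ z.addr.length * (1 / 8) := by
    calc (1 / 2 : ℝ) ^ (initial a n).length ≤ (1 / 2) ^ (z.addr.length + 3) := by
          rw [length_initial]
          exact pow_le_pow_of_le_one (by norm_num) (by norm_num) hn
      _ = _ := by rw [pow_add]; norm_num
  have h7 := le_of_abs_le h3
  have h8 := dist_triangle_left (ray a n) (mk z : CompletedSurface) (endPoint a)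
  rw [dist_comm] at h2
  unfold ray at h2 h8
  linarith

theorem stringMetric_dist_le_dist_endPoint (a b : ℕ → Bool) :
    stringMetric.dist a b ≤ dist (endPoint a) (endPoint b) := by
  rcases eq_or_ne a b with rfl | h
  · simp
  rw [stringMetric_dist h]
  refine ge_of_tendsto ((tendsto_ray a).dist (tendsto_ray b)) ?_
  filter_upwards [eventually_ge_atTop (PiNat.firstDiff a b + 1)] with n hn
  have e : initial a (PiNat.firstDiff a b) = initial b (PiNat.firstDiff a b) :=
    initial_congr fun i hi => PiNat.apply_eq_of_lt_firstDiff hi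
  have ha := initial_prefix a hn
  have hb := initial_prefix b hn
  rw [initial_succ] at ha hb
  rw [← e] at hb
  have := pow_le_dist_of_prefix (PiNat.apply_firstDiff_ne h) (x := basePiece (initial a n))
    (y := basePiece (initial b n)) ha hb
  rwa [length_initial, ← UniformSpace.Completion.dist_eq] at this

/-- The factor `3` counts two tails, from index `n + 1` on, and one crossing of the last common
quad-T, which contains both points of index `n + 1`; each costs `M * 2 ^ (-n)`. -/
theorem dist_endPoint_le {M : ℝ}
    (hM : ∀ s, ∀ x ∈ quadT s, ∀ y ∈ quadT s, dist x y ≤ M * (1 / 2) ^ s.length)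
    (a b : ℕ → Bool) : dist (endPoint a) (endPoint b) ≤ 3 * M * stringMetric.dist a b := by
  rcases eq_or_ne a b with rfl | h
  · simp
  rw [stringMetric_dist h]
  set n := PiNat.firstDiff a b
  have e : initial a n = initial b n :=
    initial_congr fun i hi => PiNat.apply_eq_of_lt_firstDiff hi
  have key : ∀ c, dist (ray c (n + 1)) (endPoint c) ≤ M * (1 / 2) ^ n := by
    intro c
    have := dist_le_of_le_geometric_of_tendsto (1 / 2) M (by norm_num) (dist_ray_succ_le hM c)
      (tendsto_ray c) (n + 1)
    refine this.trans_eq ?_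
    rw [pow_succ]
    ring
  have h1 := hM _ _ (ray_succ_mem_quadT a n) (ray b (n + 1)) (e ▸ ray_succ_mem_quadT b n)
  rw [length_initial] at h1
  have h2 := key a
  rw [dist_comm] at h2
  linarith [key b, dist_triangle4 (endPoint a) (ray a (n + 1)) (ray b (n + 1)) (endPoint b)]

theorem endPoint_injective : Function.Injective endPoint := by
  intro a b h
  by_contra hne
  have := stringMetric_dist_le_dist_endPoint a b
  rw [h, dist_self, stringMetric_dist hne] at this
  exact absurd this (not_le.2 (by positivity))

/-! ### Addresses, and surjectivity of the end point map. -/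

theorem isAddress_iff (x : CompletedSurface) (a : ℕ → Bool) :
    IsAddress x a ↔ x = endPoint a := by
  constructor
  · rintro ⟨y, hy, hx⟩
    -- The given sequence and the ray share quad-Ts of diameter tending to `0`.
    refine tendsto_nhds_unique (hx.congr_dist ?_) (tendsto_ray a)
    refine squeeze_zero (g := fun n => 14 * (1 / 2 : ℝ) ^ n) (fun n => dist_nonneg) (fun n => ?_) ?_
    · have := dist_le_of_mem_quadT (coe_mem_quadT (hy n)) (ray_mem_quadT a n)
      rwa [length_initial] at this
    · simpa using (tendsto_pow_atTop_nhds_zero_of_lt_one (r := (1 / 2 : ℝ))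
        (by norm_num) (by norm_num)).const_mul 14
  · rintro rfl
    exact ⟨_, fun n => mk_basePiece_mem _, tendsto_ray a⟩

/-- Points of the surface near an elusive singularity lie in small polygons. -/
theorem exists_piece_near {x : CompletedSurface} (hx : x ∈ elusive) (n : ℕ) {ε : ℝ} (hε : 0 < ε) :
    ∃ z : Piece, dist (mk z : CompletedSurface) x < ε ∧ n ≤ z.addr.length := by
  -- Only finitely many strings are shorter than `n`, so the union is closed and misses a ball
  -- around `x`.
  have hc : IsClosed (⋃ s ∈ {s : List Bool | s.length < n}, quadT s) :=
    (List.finite_length_lt Bool n).isClosed_biUnion fun _ _ => isClosed_closure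
  have hx' : x ∈ (⋃ s ∈ {s : List Bool | s.length < n}, quadT s)ᶜ := fun h => by
    obtain ⟨s, -, hs⟩ := mem_iUnion₂.1 h
    exact hx.2 (mem_iUnion.2 ⟨s, hs⟩)
  obtain ⟨δ, hδ, hball⟩ := Metric.isOpen_iff.1 hc.isOpen_compl x hx'
  obtain ⟨z, hz⟩ := UniformSpace.Completion.denseRange_coe.exists_dist_lt x (lt_min hε hδ)
  obtain ⟨z, rfl⟩ := exists_mk z
  rw [dist_comm] at hz
  refine ⟨z, hz.trans_le (min_le_left _ _), not_lt.1 fun hlt => ?_⟩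
  exact hball (hz.trans_le (min_le_right _ _))
    (mem_iUnion₂.2 ⟨z.addr, hlt, coe_mem_quadT (openQuadT_mem z)⟩)

theorem exists_prefix_of_take_ne {t t' : List Bool} {n : ℕ} (ht : n ≤ t.length)
    (ht' : n ≤ t'.length) (h : t.take n ≠ t'.take n) :
    ∃ (s : List Bool) (b c : Bool), b ≠ c ∧ s.length < n ∧ s ++ [b] <+: t ∧ s ++ [c] <+: t' := by
  induction n generalizing t t' with
  | zero => simp at h
  | succ n ih =>
    obtain ⟨b, t, rfl⟩ := List.exists_cons_of_length_pos (n.succ_pos.trans_le ht)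
    obtain ⟨c, t', rfl⟩ := List.exists_cons_of_length_pos (n.succ_pos.trans_le ht')
    rcases eq_or_ne b c with rfl | hbc
    · obtain ⟨s, b', c', h1, h2, h3, h4⟩ := ih (t := t) (t' := t') (by simpa using ht)
        (by simpa using ht') (by simpa using h)
      exact ⟨b :: s, b', c', h1, by simpa using h2, by simpa using h3, by simpa using h4⟩
    · exact ⟨[], b, c, hbc, n.succ_pos, by simp, by simp⟩

theorem take_eq_of_dist_lt {x y : Piece} {n : ℕ} (hx : n ≤ x.addr.length) (hy : n ≤ y.addr.length)
    (h : dist (mk x) (mk y) < (1 / 2) ^ n) : x.addr.take n = y.addr.take n := by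
  by_contra hne
  obtain ⟨s, b, c, hbc, hs, h1, h2⟩ := exists_prefix_of_take_ne hx hy hne
  have h3 : (1 / 2 : ℝ) ^ n ≤ (1 / 2) ^ s.length :=
    pow_le_pow_of_le_one (by norm_num) (by norm_num) hs.le
  linarith [pow_le_dist_of_prefix hbc h1 h2]

theorem exists_eq_endPoint {x : CompletedSurface} (hx : x ∈ elusive) : ∃ a, x = endPoint a := by
  have hpos : ∀ n : ℕ, (0 : ℝ) < (1 / 2) ^ n / 2 := fun n => by positivity
  choose z hz hlen using fun n : ℕ => exists_piece_near hx n (hpos n)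
  have htake : ∀ m n, m ≤ n → (z m).addr.take m = (z n).addr.take m := by
    intro m n hmn
    refine take_eq_of_dist_lt (hlen m) (hmn.trans (hlen n)) ?_
    rw [← UniformSpace.Completion.dist_eq]
    have : (1 / 2 : ℝ) ^ n ≤ (1 / 2) ^ m := pow_le_pow_of_le_one (by norm_num) (by norm_num) hmn
    linarith [dist_triangle_right (mk (z m) : CompletedSurface) (mk (z n)) x, hz m, hz n]
  -- Bit `n` is read from `z (n + 1)`, the first approximant whose address is sure to have it.
  let a : ℕ → Bool := fun n => (z (n + 1)).addr[n]'(hlen (n + 1))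
  have ha : ∀ n, initial a n = (z n).addr.take n := by
    intro n
    refine List.ext_getElem (by simp [length_initial, hlen n]) fun i h1 h2 => ?_
    rw [length_initial] at h1
    have h3 : i < (z n).addr.length := h1.trans_le (hlen n)
    have e := congrArg (fun l : List Bool => l[i]?) (htake (i + 1) n h1)
    simp only [List.getElem?_take, Nat.lt_succ_self, if_true] at e
    rw [List.getElem?_eq_getElem (hlen (i + 1)), List.getElem?_eq_getElem h3] at e
    simpa [initial, a] using e
  refine ⟨a, tendsto_nhds_unique (f := ray a) ?_ (tendsto_ray a)⟩
  rw [tendsto_iff_dist_tendsto_zero]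
  -- At most `28 * 2 ^ (-n)` from the ray to `z n`, and less than `2 ^ (-n)` from there to `x`.
  refine squeeze_zero (g := fun n => 29 * (1 / 2 : ℝ) ^ n) (fun n => dist_nonneg) (fun n => ?_) ?_
  · have h1 := dist_basePiece_le_of_prefix (s := initial a n) (x := z n)
      (by rw [ha]; exact List.take_prefix _ _)
    rw [length_initial, ← UniformSpace.Completion.dist_eq] at h1
    have h2 := dist_triangle (ray a n) (mk (z n) : CompletedSurface) x
    unfold ray at h2 ⊢
    linarith [hz n, hpos n]
  · simpa using (tendsto_pow_atTop_nhds_zero_of_lt_one (r := (1 / 2 : ℝ))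
      (by norm_num) (by norm_num)).const_mul 29

/-- The bijection between infinite binary strings and elusive singularities. -/
noncomputable def endPointEquiv : (ℕ → Bool) ≃ elusive :=
  Equiv.ofBijective (fun a => ⟨endPoint a, endPoint_mem_elusive a⟩)
    ⟨fun _ _ h => endPoint_injective (Subtype.ext_iff.1 h), fun x =>
      (exists_eq_endPoint x.2).imp fun _ h => Subtype.ext h.symm⟩

theorem endPoint_endPointEquiv_symm (x : elusive) : endPoint (endPointEquiv.symm x) = x :=
  Subtype.ext_iff.1 (endPointEquiv.apply_symm_apply x)

end TFractal

theorem mainTheorem1 :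
    ∃ α : TFractal.elusive ≃ (ℕ → Bool),
      (∀ (x : TFractal.elusive) (a : ℕ → Bool),
        TFractal.IsAddress (x : TFractal.CompletedSurface) a ↔ a = α x) ∧
      TFractal.IsCantorSetOfDim TFractal.elusive inferInstance 1 ∧
      TFractal.IsCantorSetOfDim TFractal.elusive (TFractal.twoAdicMetric α) 1 ∧
      (∃ M : ℝ, ∀ s : List Bool, ∀ x ∈ TFractal.quadT s, ∀ y ∈ TFractal.quadT s,
        dist x y ≤ M * (1 / 2) ^ s.length) ∧
      ∀ M : ℝ,
        (∀ s : List Bool, ∀ x ∈ TFractal.quadT s, ∀ y ∈ TFractal.quadT s,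
          dist x y ≤ M * (1 / 2) ^ s.length) →
        ∀ x y : TFractal.elusive,
          (TFractal.twoAdicMetric α).dist x y ≤ dist (x : TFractal.CompletedSurface) y ∧
          dist (x : TFractal.CompletedSurface) y ≤
            3 * M * (TFractal.twoAdicMetric α).dist x y := by
  have h₁ : ∀ x y : TFractal.elusive, TFractal.stringMetric.dist (TFractal.endPointEquiv.symm x)
      (TFractal.endPointEquiv.symm y) ≤ dist (x : TFractal.CompletedSurface) y := fun x y => by
    simpa only [TFractal.endPoint_endPointEquiv_symm] using
      TFractal.stringMetric_dist_le_dist_endPoint (TFractal.endPointEquiv.symm x)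
        (TFractal.endPointEquiv.symm y)
  have h₂ : ∀ M : ℝ, (∀ s : List Bool, ∀ x ∈ TFractal.quadT s, ∀ y ∈ TFractal.quadT s,
      dist x y ≤ M * (1 / 2) ^ s.length) → ∀ x y : TFractal.elusive,
      dist (x : TFractal.CompletedSurface) y ≤ 3 * M * TFractal.stringMetric.dist
        (TFractal.endPointEquiv.symm x) (TFractal.endPointEquiv.symm y) := fun M hM x y => by
    simpa only [TFractal.endPoint_endPointEquiv_symm] using
      TFractal.dist_endPoint_le hM (TFractal.endPointEquiv.symm x) (TFractal.endPointEquiv.symm y)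
  have h14 : ∀ s : List Bool, ∀ x ∈ TFractal.quadT s, ∀ y ∈ TFractal.quadT s,
      dist x y ≤ 14 * (1 / 2) ^ s.length := fun _ _ hx _ hy => TFractal.dist_le_of_mem_quadT hx hy
  refine ⟨TFractal.endPointEquiv.symm, fun x a => ?_,
    TFractal.isCantorSetOfDim_one _ TFractal.endPointEquiv.symm _ h₁ (h₂ 14 h14),
    TFractal.isCantorSetOfDim_one (TFractal.twoAdicMetric _) TFractal.endPointEquiv.symm 1
      (fun x y => le_rfl) (fun x y => (one_mul _).ge), ⟨14, h14⟩, fun M hM x y => ⟨h₁ x y, h₂ M hM x y⟩⟩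
  rw [TFractal.isAddress_iff, ← TFractal.endPoint_endPointEquiv_symm x,
    TFractal.endPoint_injective.eq_iff, eq_comm]
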